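/- Let $d\in\mathbb N$, let $\Omega\subset\mathbb R^d$ be bounded, let $\tau>d/2$ and $\varepsilon\in(0,1)$. Then there exists a constant $a>0$, depending only on $\varepsilon,d,\tau,\Omega$, such that the following holds for every finite set $X=\{x_1,\dots,x_n\}\subset\Omega$ of $n\ge 2$ pairwise distinct points, with separation distance $q_X:=\min_{j\ne k}\|x_j-x_k\|$, and for every $\alpha=(\alpha_1,\dots,\alpha_n)\in\mathbb R^n$. The function $\omega\mapsto(1+\|\omega\|^2)^{-\tau}\bigl|\sum_{j=1}^n\alpha_j e^{i\omega^\top x_j}\bigr|^2$ is integrable on $\mathbb R^d$, and for every $R\ge \frac{\max(a,\pi)}{q_X}$ $$(1-\varepsilon)\int_{\mathbb R^d}(1+\|\omega\|^2)^{-\tau}\Bigl|\sum_{j=1}^n\alpha_j e^{i\omega^\top x_j}\Bigr|^2\,\mathrm d\omega\;\le\;\int_{B_{2R}}(1+\|\omega\|^2)^{-\tau}\Bigl|\sum_{j=1}^n\alpha_j e^{i\omega^\top x_j}\Bigr|^2\,\mathrm d\omega,$$ where $\|\cdot\|$ is the Euclidean norm and $B_{2R}$ is the ball of radius $2R$ around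 the origin in $\mathbb R^d$. -/

import Mathlib

open MeasureTheory

/-- The separation distance of a finite point set: the least distance between two distinct
points of `X`. It is Mathlib's infimum separation, which is the minimum over the pairs of
distinct points as soon as `X` has at least two points (see `separationDistance_eq_min`). -/
noncomputable def separationDistance {d : ℕ} (X : Finset (EuclideanSpace ℝ (Fin d))) : ℝ :=
  (X : Set (EuclideanSpace ℝ (Fin d))).infsep

theorem separationDistance_eq_min {d : ℕ} {X : Finset (EuclideanSpace ℝ (Fin d))}
    (hX : X.Nontrivial) :
    IsLeast {r : ℝ | ∃ x ∈ X, ∃ y ∈ X, x ≠ y ∧ r = ‖x - y‖} (separationDistance X) := by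
  constructor
  · obtain ⟨x, hx, y, hy, hxy, h⟩ :=
      X.finite_toSet.infsep_exists_of_nontrivial hX
    exact ⟨x, by simpa using hx, y, by simpa using hy, hxy, by
      rw [separationDistance, h, dist_eq_norm]⟩
  · rintro r ⟨x, hx, y, hy, hxy, rfl⟩
    rw [← dist_eq_norm]
    exact Set.infsep_le_dist_of_mem (s := (X : Set (EuclideanSpace ℝ (Fin d)))) hx hy hxy

/-- The exponential sum `ω ↦ ∑ x ∈ X, α x * exp (i ⟪ω, x⟫)` with real coefficients `α`. -/
noncomputable def exponentialSum {d : ℕ} (X : Finset (EuclideanSpace ℝ (Fin d)))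
    (α : X → ℝ) (ω : EuclideanSpace ℝ (Fin d)) : ℂ :=
  ∑ x : X, (α x : ℂ) *
    Complex.exp (Complex.I * ((inner ℝ ω (x : EuclideanSpace ℝ (Fin d)) : ℝ) : ℂ))

/-! Write `S` for the exponential sum and `q` for the separation distance. Let `k = |𝓕 φ|²`, where
`φ` is a bump of small support. Translates of `φ` along the suitably rescaled points have disjoint
supports, so Plancherel turns `∫ |S(ω)|² k(tω) dω` into exactly `A t⁻ᵈ ∑ α²` for `0 < t ≤ q`
(`exists_localizing_kernel`). This identity serves twice. As `k` is bounded below near 0, it bounds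
the mean square of `S` on balls of radius at least of order `1/q`; summed over dyadic shells, this
bounds the energy outside `B_M` by `C M^(d-2τ) ∑ α²`. As `k` decays rapidly, the weight dominates a
multiple of `q^(2τ) k(qω)`, so the whole energy is at least `c q^(2τ-d) ∑ α²`. For `M ≥ a/q` the
powers of `q` cancel, and the tail is at most the fraction `C a^(d-2τ) / c` of the energy, which is
small for large `a` since `2τ > d`. -/

open scoped FourierTransform

/-! ### Plancherel for sums of separated translates. -/

/-- Functions with pairwise disjoint supports are orthogonal: the square of the sum of translates
of `φ` is the sum of the squares when the translation vectors are far apart. -/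
theorem sq_sum_translates {E ι : Type*} [NormedAddCommGroup E] [Fintype ι] {r : ℝ}
    {φ : E → ℝ} (hφ : ∀ y, r ≤ ‖y‖ → φ y = 0) {z : ι → E}
    (hz : ∀ i j, i ≠ j → 2 * r ≤ ‖z i - z j‖) (a : ι → ℝ) (y : E) :
    (∑ i, a i * φ (y + z i)) ^ 2 = ∑ i, a i ^ 2 * φ (y + z i) ^ 2 := by
  classical
  rw [sq, Finset.sum_mul_sum]
  refine Finset.sum_congr rfl fun i _ => ?_
  rw [Finset.sum_eq_single i]
  · ring
  · intro j _ hj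
    by_cases hi : φ (y + z i) = 0
    · simp [hi]
    have hj' : φ (y + z j) = 0 := by
      apply hφ
      have h1 : ‖y + z i‖ < r := not_le.1 fun h => hi (hφ _ h)
      have h2 := hz i j hj.symm
      have h3 : ‖z i - z j‖ ≤ ‖y + z i‖ + ‖y + z j‖ := by
        have := norm_sub_le (y + z i) (y + z j)
        rwa [add_sub_add_left_eq_sub] at this
      linarith
    simp [hj']
  · simp

theorem fourier_sum_translates {V ι : Type*} [NormedAddCommGroup V] [InnerProductSpace ℝ V]
    [FiniteDimensional ℝ V] [MeasurableSpace V] [BorelSpace V] [Fintype ι]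
    {φ : V → ℂ} (hφ : Integrable φ) (z : ι → V) (a : ι → ℂ) (w : V) :
    𝓕 (fun y => ∑ i, a i * φ (y + z i)) w
      = (∑ i, a i * Complex.exp (Complex.I * ((2 * Real.pi * inner ℝ w (z i) : ℝ) : ℂ))) * 𝓕 φ w := by
  have key (i : ι) : 𝓕 (fun y => φ (y + z i)) w
      = Complex.exp (Complex.I * ((2 * Real.pi * inner ℝ w (z i) : ℝ) : ℂ)) * 𝓕 φ w := by
    have h := congrFun (VectorFourier.fourierIntegral_comp_add_right Real.fourierChar
      (volume : Measure V) (innerₗ V) φ (z i)) w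
    have h' : 𝓕 (fun y => φ (y + z i)) w = Real.fourierChar (innerₗ V (z i) w) • 𝓕 φ w := h
    rw [h', Circle.smul_def, Real.fourierChar_apply, smul_eq_mul, innerₗ_apply_apply,
      real_inner_comm, mul_comm Complex.I]
  rw [Finset.sum_mul, Finset.sum_congr rfl fun i _ => by rw [mul_assoc, ← key i]]
  simp_rw [Real.fourier_eq, Finset.smul_sum]
  rw [integral_finsetSum]
  · refine Finset.sum_congr rfl fun i _ => ?_
    rw [← integral_const_mul]
    simp_rw [mul_smul_comm]
  · intro i _
    exact (Real.fourierIntegral_convergent_iff w).2 ((hφ.comp_add_right (z i)).const_mul (a i))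

theorem hasCompactSupport_sq {V : Type*} [TopologicalSpace V] {φ : V → ℝ}
    (hφ : HasCompactSupport φ) : HasCompactSupport fun y => φ y ^ 2 := by
  have h : (fun y => φ y ^ 2) = (fun t : ℝ => t ^ 2) ∘ φ := rfl
  rw [h]
  exact hφ.comp_left (by simp)

theorem exists_schwartzMap_eq {V : Type*} [NormedAddCommGroup V] [InnerProductSpace ℝ V]
    [FiniteDimensional ℝ V] [MeasurableSpace V] [BorelSpace V] {G : V → ℂ}
    (hsm : ContDiff ℝ (⊤ : ℕ∞) G) (hcs : HasCompactSupport G) :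
    ∃ F : SchwartzMap V ℂ, (∀ y, F y = G y) ∧ ∀ w, 𝓕 F w = 𝓕 G w :=
  ⟨hcs.toSchwartzMap hsm, fun _ => rfl, fun _ => rfl⟩

/-- **Plancherel for separated translates.** -/
theorem integral_norm_sq_sum_mul_norm_sq_fourier {V ι : Type*} [NormedAddCommGroup V]
    [InnerProductSpace ℝ V] [FiniteDimensional ℝ V] [MeasurableSpace V] [BorelSpace V] [Fintype ι]
    {r : ℝ} {φ : V → ℝ} (hsm : ContDiff ℝ (⊤ : ℕ∞) φ) (hcs : HasCompactSupport φ)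
    (hφ : ∀ y, r ≤ ‖y‖ → φ y = 0) {z : ι → V}
    (hz : ∀ i j, i ≠ j → 2 * r ≤ ‖z i - z j‖) (a : ι → ℝ) :
    ∫ w : V, ‖∑ i, (a i : ℂ) * Complex.exp (Complex.I * ((2 * Real.pi * inner ℝ w (z i) : ℝ) : ℂ))‖ ^ 2
        * ‖𝓕 (fun y => (φ y : ℂ)) w‖ ^ 2 = (∫ y, φ y ^ 2) * ∑ i, a i ^ 2 := by
  have hcont : Continuous φ := hsm.continuous
  have hint : Integrable (fun y => (φ y : ℂ)) :=
    (hcont.integrable_of_hasCompactSupport hcs).ofReal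
  have hsq : Integrable (fun y => φ y ^ 2) :=
    (hcont.pow 2).integrable_of_hasCompactSupport (hasCompactSupport_sq hcs)
  let G : V → ℂ := fun y => ∑ i, (a i : ℂ) * (φ (y + z i) : ℂ)
  have hGcs : HasCompactSupport G := by
    have (i : ι) : HasCompactSupport fun y => (a i : ℂ) * (φ (y + z i) : ℂ) := by
      have h1 : HasCompactSupport fun y => φ (y + z i) :=
        hcs.comp_homeomorph (Homeomorph.addRight (z i))
      have h2 : HasCompactSupport fun y => (φ (y + z i) : ℂ) :=
        h1.comp_left (g := fun t : ℝ => (t : ℂ)) Complex.ofReal_zero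
      exact h2.mul_left
    have hG : G = ∑ i, fun y => (a i : ℂ) * (φ (y + z i) : ℂ) := by
      ext y; simp [G]
    rw [hG]
    refine Finset.sum_induction _ HasCompactSupport (fun _ _ h h' => h.add h') ?_
      (fun i _ => this i)
    exact HasCompactSupport.zero
  have hGsm : ContDiff ℝ (⊤ : ℕ∞) G := by
    refine ContDiff.sum fun i _ => contDiff_const.mul ?_
    exact Complex.ofRealCLM.contDiff.comp (hsm.comp (contDiff_id.add contDiff_const))
  obtain ⟨F, hFG, hF⟩ := exists_schwartzMap_eq hGsm hGcs
  have hP := SchwartzMap.integral_norm_sq_fourier F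
  simp_rw [hF, hFG] at hP
  have h1 (w : V) := fourier_sum_translates hint z (fun i => (a i : ℂ)) w
  simp_rw [← mul_pow, ← norm_mul, ← h1]
  rw [show (fun y => ∑ i, (a i : ℂ) * (φ (y + z i) : ℂ)) = G from rfl, hP]
  have h2 (y : V) : ‖G y‖ ^ 2 = ∑ i, a i ^ 2 * φ (y + z i) ^ 2 := by
    rw [← sq_sum_translates hφ hz a y, ← sq_abs (∑ i, _), ← Real.norm_eq_abs, ← Complex.norm_real]
    simp [G]
  simp_rw [h2]
  rw [integral_finsetSum _ fun i _ => (hsq.comp_add_right (z i)).const_mul _, mul_comm,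
    Finset.sum_mul]
  refine Finset.sum_congr rfl fun i _ => ?_
  rw [integral_const_mul, integral_add_right_eq_self (fun y => φ y ^ 2)]

/-! ### The localizing kernel. -/

theorem exists_localizing_kernel (d : ℕ) :
    ∃ k : EuclideanSpace ℝ (Fin d) → ℝ, ∃ A : ℝ, 0 < A ∧ Continuous k ∧ Integrable k ∧
      (∀ w, 0 ≤ k w) ∧ 0 < k 0 ∧ (∀ n : ℕ, ∃ C, ∀ w, (1 + ‖w‖) ^ n * k w ≤ C) ∧
      ∀ (X : Finset (EuclideanSpace ℝ (Fin d))) (α : X → ℝ) (t : ℝ), 0 < t →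
        t ≤ separationDistance X →
        ∫ ω, ‖exponentialSum X α ω‖ ^ 2 * k (t • ω) = A * (t ^ d)⁻¹ * ∑ x, α x ^ 2 := by
  have hpi := Real.pi_pos
  -- The outer radius is half of `1 / (2π)`, the least gap between the points `x / (2πt)` when `t ≤
  -- q`. The inner radius only has to be smaller.
  let φ : ContDiffBump (0 : EuclideanSpace ℝ (Fin d)) :=
    ⟨1 / (8 * Real.pi), 1 / (4 * Real.pi), by positivity, by gcongr; norm_num⟩
  have hsm : ContDiff ℝ (⊤ : ℕ∞) φ := φ.contDiff
  have hcs : HasCompactSupport φ := φ.hasCompactSupport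
  have hcsC : HasCompactSupport fun y => (φ y : ℂ) :=
    hcs.comp_left (g := fun t : ℝ => (t : ℂ)) Complex.ofReal_zero
  have hsmC : ContDiff ℝ (⊤ : ℕ∞) fun y => (φ y : ℂ) := Complex.ofRealCLM.contDiff.comp hsm
  obtain ⟨g, hg⟩ : ∃ g : SchwartzMap (EuclideanSpace ℝ (Fin d)) ℂ,
      ∀ w, g w = 𝓕 (fun y => (φ y : ℂ)) w := by
    obtain ⟨F, -, hF⟩ := exists_schwartzMap_eq hsmC hcsC
    exact ⟨𝓕 F, hF⟩
  have hsq : Integrable (fun y => φ y ^ 2) :=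
    (φ.continuous.pow 2).integrable_of_hasCompactSupport (hasCompactSupport_sq hcs)
  have hone : φ 0 = 1 := φ.one_of_mem_closedBall (by simp [φ.rIn_pos.le])
  refine ⟨fun w => ‖g w‖ ^ 2, ∫ y, φ y ^ 2, ?_, by fun_prop, ?_, fun w => by positivity, ?_, ?_, ?_⟩
  · exact (φ.continuous.pow 2).integral_pos_of_hasCompactSupport_nonneg_nonzero (hasCompactSupport_sq hcs) (fun y => by positivity)
      (x := 0) (by simp [hone])
  · exact (g.memLp 2 volume).integrable_norm_pow (by norm_num)
  · have : g 0 = ((∫ y, φ y : ℝ) : ℂ) := by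
      rw [hg, Real.fourier_eq, ← integral_complex_ofReal]
      simp
    beta_reduce
    rw [this]
    have := φ.integral_pos (μ := volume)
    exact pow_pos (norm_pos_iff.2 (Complex.ofReal_ne_zero.2 this.ne')) 2
  · intro n
    obtain ⟨C, hC⟩ : ∃ C, ∀ w, (1 + ‖w‖) ^ n * ‖g w‖ ≤ C := by
      have (w : EuclideanSpace ℝ (Fin d)) := SchwartzMap.one_add_le_sup_seminorm_apply (𝕜 := ℝ) (m := (n, 0)) (k := n) (n := 0)
        le_rfl le_rfl g w
      simp only [norm_iteratedFDeriv_zero] at this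
      exact ⟨_, this⟩
    refine ⟨C ^ 2, fun w => ?_⟩
    have h1 : (1 : ℝ) ≤ (1 + ‖w‖) ^ n := one_le_pow₀ (by linarith [norm_nonneg w])
    calc (1 + ‖w‖) ^ n * ‖g w‖ ^ 2 ≤ ((1 + ‖w‖) ^ n) ^ 2 * ‖g w‖ ^ 2 := by
          gcongr; exact le_self_pow₀ h1 two_ne_zero
      _ = ((1 + ‖w‖) ^ n * ‖g w‖) ^ 2 := by ring
      _ ≤ C ^ 2 := by gcongr; exact hC w
  · intro X α t ht htX
    -- This scaling gives `2π⟪tω, z x⟫ = ⟪ω, x⟫`, absorbing the `2π` in the normalization of `𝓕`.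
    let z : X → EuclideanSpace ℝ (Fin d) := fun x => (2 * Real.pi * t)⁻¹ • (x : EuclideanSpace ℝ (Fin d))
    have hz : ∀ i j, i ≠ j → 2 * (1 / (4 * Real.pi)) ≤ ‖z i - z j‖ := by
      intro i j hij
      have h1 : separationDistance X ≤ ‖(i : EuclideanSpace ℝ (Fin d)) - j‖ := by
        rw [← dist_eq_norm]
        exact Set.infsep_le_dist_of_mem (s := (X : Set (EuclideanSpace ℝ (Fin d))))
          i.2 j.2 (fun h => hij (Subtype.ext h))
      rw [← smul_sub, norm_smul, Real.norm_of_nonneg (by positivity)]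
      calc 2 * (1 / (4 * Real.pi)) = (2 * Real.pi * t)⁻¹ * t := by field_simp; norm_num
        _ ≤ _ := by gcongr; exact htX.trans h1
    have hφ : ∀ y, 1 / (4 * Real.pi) ≤ ‖y‖ → φ y = 0 := fun y hy =>
      φ.zero_of_le_dist (by simpa [φ] using hy)
    have key := integral_norm_sq_sum_mul_norm_sq_fourier hsm hcs hφ hz α
    have hS (ω) : exponentialSum X α ω = ∑ i, (α i : ℂ) *
        Complex.exp (Complex.I * ((2 * Real.pi * inner ℝ (t • ω) (z i) : ℝ) : ℂ)) := by
      refine Finset.sum_congr rfl fun i _ => ?_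
      rw [inner_smul_left, inner_smul_right]
      congr 4
      simp
      field_simp
    have hsc := Measure.integral_comp_smul_of_nonneg (volume : Measure (EuclideanSpace ℝ (Fin d)))
      (fun w => ‖∑ i, (α i : ℂ) * Complex.exp (Complex.I *
        ((2 * Real.pi * inner ℝ w (z i) : ℝ) : ℂ))‖ ^ 2 * ‖𝓕 (fun y => (φ y : ℂ)) w‖ ^ 2) t
        (hR := ht.le)
    simp_rw [hS, hg]
    rw [hsc, key, finrank_euclideanSpace_fin, smul_eq_mul]
    ring

/-! ### Integrability of the weighted energy. -/

theorem continuous_exponentialSum {d : ℕ} (X : Finset (EuclideanSpace ℝ (Fin d))) (α : X → ℝ) :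
    Continuous (exponentialSum X α) := by
  unfold exponentialSum
  fun_prop

theorem norm_exponentialSum_le {d : ℕ} (X : Finset (EuclideanSpace ℝ (Fin d))) (α : X → ℝ)
    (ω : EuclideanSpace ℝ (Fin d)) : ‖exponentialSum X α ω‖ ≤ ∑ x, |α x| := by
  refine (norm_sum_le _ _).trans (Finset.sum_le_sum fun x _ => ?_)
  rw [norm_mul, mul_comm Complex.I, Complex.norm_exp_ofReal_mul_I, mul_one, Complex.norm_real,
    Real.norm_eq_abs]

theorem integrable_mul_norm_sq_exponentialSum {d : ℕ} (X : Finset (EuclideanSpace ℝ (Fin d)))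
    (α : X → ℝ) {h : EuclideanSpace ℝ (Fin d) → ℝ} (hh : Integrable h) :
    Integrable fun ω => h ω * ‖exponentialSum X α ω‖ ^ 2 := by
  refine hh.mul_bdd (c := (∑ x, |α x|) ^ 2)
    ((continuous_exponentialSum X α).norm.pow 2).aestronglyMeasurable (.of_forall fun ω => ?_)
  rw [Real.norm_of_nonneg (by positivity)]
  gcongr
  exact norm_exponentialSum_le X α ω

theorem integrable_weight {d : ℕ} {τ : ℝ} (hτ : (d : ℝ) / 2 < τ) :
    Integrable fun ω : EuclideanSpace ℝ (Fin d) => (1 + ‖ω‖ ^ 2) ^ (-τ) := by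
  have := integrable_rpow_neg_one_add_norm_sq (E := EuclideanSpace ℝ (Fin d)) (μ := volume)
    (r := 2 * τ) (by rw [finrank_euclideanSpace_fin]; linarith)
  convert this using 3
  ring

/-! ### Upper and lower bounds in terms of the sum of squared coefficients. -/

/-- A large sieve inequality: on balls of radius at least of order `1 / q_X`, the mean square of
the exponential sum is bounded by the sum of the squares of the coefficients. -/
theorem exists_setIntegral_ball_le (d : ℕ) :
    ∃ ρ : ℝ, 0 < ρ ∧ ∃ C : ℝ, 0 ≤ C ∧
      ∀ (X : Finset (EuclideanSpace ℝ (Fin d))) (α : X → ℝ) (r : ℝ), 0 < separationDistance X →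
        ρ / separationDistance X ≤ r →
        ∫ ω in Metric.ball 0 r, ‖exponentialSum X α ω‖ ^ 2 ≤ C * r ^ d * ∑ x, α x ^ 2 := by
  obtain ⟨k, A, hA, hkc, hki, hk0, hkpos, -, hk⟩ := exists_localizing_kernel d
  obtain ⟨ρ, hρ, hρk⟩ := Metric.eventually_nhds_iff_ball.1
    (hkc.continuousAt.eventually (lt_mem_nhds (half_lt_self hkpos)))
  refine ⟨ρ, hρ, 2 / k 0 * A * (ρ ^ d)⁻¹, by positivity, fun X α r hq hr => ?_⟩
  have hr0 : 0 < r := (div_pos hρ hq).trans_le hr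
  -- The scale `t = ρ / r` maps the ball of radius `r` into the one where `k > k 0 / 2`; `t ≤ q` is
  -- the assumption on `r`.
  have ht : 0 < ρ / r := by positivity
  have hint : Integrable fun ω => 2 / k 0 * k ((ρ / r) • ω) * ‖exponentialSum X α ω‖ ^ 2 :=
    integrable_mul_norm_sq_exponentialSum X α ((hki.comp_smul ht.ne').const_mul _)
  calc ∫ ω in Metric.ball 0 r, ‖exponentialSum X α ω‖ ^ 2
      ≤ ∫ ω in Metric.ball 0 r, 2 / k 0 * k ((ρ / r) • ω) * ‖exponentialSum X α ω‖ ^ 2 := by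
        refine setIntegral_mono_on ?_ hint.integrableOn measurableSet_ball fun ω hω => ?_
        · exact (((continuous_exponentialSum X α).norm.pow 2).continuousOn.integrableOn_compact
            (isCompact_closedBall 0 r)).mono_set Metric.ball_subset_closedBall
        · have h1 : (ρ / r) • ω ∈ Metric.ball (0 : EuclideanSpace ℝ (Fin d)) ρ := by
            rw [mem_ball_zero_iff] at hω ⊢
            rw [norm_smul, Real.norm_of_nonneg ht.le]
            calc ρ / r * ‖ω‖ < ρ / r * r := by gcongr
              _ = ρ := by field_simp
          have h2 : 1 ≤ 2 / k 0 * k ((ρ / r) • ω) := by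
            calc 1 = 2 / k 0 * (k 0 / 2) := by field_simp
              _ ≤ _ := by gcongr; exact (hρk _ h1).le
          exact le_mul_of_one_le_left (by positivity) h2
    _ ≤ ∫ ω, 2 / k 0 * k ((ρ / r) • ω) * ‖exponentialSum X α ω‖ ^ 2 :=
        setIntegral_le_integral hint (.of_forall fun ω => by
          have := hk0 ((ρ / r) • ω); positivity)
    _ = 2 / k 0 * ∫ ω, ‖exponentialSum X α ω‖ ^ 2 * k ((ρ / r) • ω) := by
        rw [← integral_const_mul]
        congr with ω
        ring
    _ = _ := by
        rw [hk X α _ ht ((div_le_comm₀ hq hr0).1 hr), div_pow, inv_div]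
        ring

/-- Lower bound for the weighted energy of the exponential sum. -/
theorem exists_le_integral_weight (d : ℕ) {τ : ℝ} (hτ : (d : ℝ) / 2 < τ) (D : ℝ) :
    ∃ c : ℝ, 0 < c ∧
      ∀ (X : Finset (EuclideanSpace ℝ (Fin d))) (α : X → ℝ), 0 < separationDistance X →
        separationDistance X ≤ D →
        c * separationDistance X ^ (2 * τ - d) * ∑ x, α x ^ 2 ≤
          ∫ ω, (1 + ‖ω‖ ^ 2) ^ (-τ) * ‖exponentialSum X α ω‖ ^ 2 := by
  obtain ⟨k, A, hA, hkc, hki, hk0, hkpos, hdec, hk⟩ := exists_localizing_kernel d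
  have hτ0 : 0 < τ := lt_of_le_of_lt (by positivity) hτ
  obtain ⟨n, hn⟩ := exists_nat_ge (2 * τ)
  obtain ⟨C, hC⟩ := hdec n
  have hC0 : 0 < C := by
    refine hkpos.trans_le ?_
    simpa using hC 0
  refine ⟨A / (C * (1 + |D|) ^ (2 * τ)), by positivity, fun X α hq hqD => ?_⟩
  set q := separationDistance X
  have hpt (ω : EuclideanSpace ℝ (Fin d)) :
      q ^ (2 * τ) * k (q • ω) ≤ C * (1 + |D|) ^ (2 * τ) * (1 + ‖ω‖ ^ 2) ^ (-τ) := by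
    have hη : ‖q • ω‖ = q * ‖ω‖ := by rw [norm_smul, Real.norm_of_nonneg hq.le]
    -- The bound `q ≤ D` is needed here: it controls the term `q²` coming from the 1 in the weight.
    have h0 : q ^ 2 * (1 + ‖ω‖ ^ 2) ≤ ((1 + |D|) * (1 + ‖q • ω‖)) ^ 2 := by
      have h1 : q ≤ |D| := hqD.trans (le_abs_self D)
      have h2 : q ^ 2 ≤ |D| ^ 2 := by gcongr
      have h3 := norm_nonneg (q • ω)
      have h4 := abs_nonneg D
      calc q ^ 2 * (1 + ‖ω‖ ^ 2) = q ^ 2 + ‖q • ω‖ ^ 2 := by rw [hη]; ring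
        _ ≤ |D| ^ 2 + ‖q • ω‖ ^ 2 := by gcongr
        _ ≤ (|D| + ‖q • ω‖) ^ 2 := by nlinarith [mul_nonneg h3 h4]
        _ ≤ _ := by
          gcongr
          nlinarith [mul_nonneg h3 h4]
    have h1 : q ^ (2 * τ) * (1 + ‖ω‖ ^ 2) ^ τ ≤
        (1 + |D|) ^ (2 * τ) * (1 + ‖q • ω‖) ^ n := by
      calc q ^ (2 * τ) * (1 + ‖ω‖ ^ 2) ^ τ = (q ^ 2 * (1 + ‖ω‖ ^ 2)) ^ τ := by
            rw [Real.mul_rpow (by positivity) (by positivity), Real.rpow_mul hq.le, Real.rpow_two]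
        _ ≤ (((1 + |D|) * (1 + ‖q • ω‖)) ^ 2) ^ τ := by gcongr
        _ = (1 + |D|) ^ (2 * τ) * (1 + ‖q • ω‖) ^ (2 * τ) := by
            rw [← Real.rpow_two, ← Real.rpow_mul (by positivity),
              Real.mul_rpow (by positivity) (by positivity)]
        _ ≤ _ := by
            rw [← Real.rpow_natCast _ n]
            gcongr
            linarith [norm_nonneg (q • ω)]
    rw [Real.rpow_neg (by positivity), ← div_eq_mul_inv, le_div_iff₀ (by positivity)]
    calc q ^ (2 * τ) * k (q • ω) * (1 + ‖ω‖ ^ 2) ^ τ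
        = q ^ (2 * τ) * (1 + ‖ω‖ ^ 2) ^ τ * k (q • ω) := by ring
      _ ≤ (1 + |D|) ^ (2 * τ) * (1 + ‖q • ω‖) ^ n * k (q • ω) := by
          gcongr
          exact hk0 _
      _ = (1 + |D|) ^ (2 * τ) * ((1 + ‖q • ω‖) ^ n * k (q • ω)) := by ring
      _ ≤ (1 + |D|) ^ (2 * τ) * C := by gcongr; exact hC _
      _ = _ := by ring
  have hI : ∫ ω, q ^ (2 * τ) * k (q • ω) * ‖exponentialSum X α ω‖ ^ 2 ≤
      ∫ ω, C * (1 + |D|) ^ (2 * τ) * (1 + ‖ω‖ ^ 2) ^ (-τ) * ‖exponentialSum X α ω‖ ^ 2 := by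
    refine integral_mono
      (integrable_mul_norm_sq_exponentialSum X α ((hki.comp_smul hq.ne').const_mul _))
      (integrable_mul_norm_sq_exponentialSum X α ((integrable_weight hτ).const_mul _)) fun ω => ?_
    exact mul_le_mul_of_nonneg_right (hpt ω) (by positivity)
  have hL : ∫ ω, q ^ (2 * τ) * k (q • ω) * ‖exponentialSum X α ω‖ ^ 2
      = A * q ^ (2 * τ - d) * ∑ x, α x ^ 2 := by
    rw [Real.rpow_sub hq, Real.rpow_natCast]
    calc _ = ∫ ω, q ^ (2 * τ) * (‖exponentialSum X α ω‖ ^ 2 * k (q • ω)) := by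
          congr with ω
          ring
      _ = _ := by rw [integral_const_mul, hk X α q hq le_rfl]; ring
  simp_rw [mul_assoc (C * (1 + |D|) ^ (2 * τ))] at hI
  rw [hL, integral_const_mul] at hI
  rw [div_mul_eq_mul_div, div_mul_eq_mul_div, div_le_iff₀ (by positivity)]
  linarith

/-! ### Tail estimate by dyadic shells. -/

/-- The contribution of the frequencies outside a ball to the weighted energy. -/
theorem exists_integral_weight_tail_le (d : ℕ) {τ : ℝ} (hτ : (d : ℝ) / 2 < τ) :
    ∃ ρ : ℝ, 0 < ρ ∧ ∃ C : ℝ, 0 ≤ C ∧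
      ∀ (X : Finset (EuclideanSpace ℝ (Fin d))) (α : X → ℝ) (M : ℝ), 0 < separationDistance X →
        ρ / separationDistance X ≤ M →
        ∫ ω, (1 + ‖ω‖ ^ 2) ^ (-τ) * ‖exponentialSum X α ω‖ ^ 2 ≤
          (∫ ω in Metric.ball 0 M, (1 + ‖ω‖ ^ 2) ^ (-τ) * ‖exponentialSum X α ω‖ ^ 2) +
            C * M ^ ((d : ℝ) - 2 * τ) * ∑ x, α x ^ 2 := by
  obtain ⟨ρ, hρ, C, hC, hball⟩ := exists_setIntegral_ball_le d
  have hτ0 : 0 < τ := lt_of_le_of_lt (by positivity) hτ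
  -- Ratio of the bounds for consecutive shells: doubling the radius costs `2 ^ d` in the mean
  -- square and gains `2 ^ (2τ)` from the weight.
  set θ : ℝ := 2 ^ ((d : ℝ) - 2 * τ) with hθ
  have hθ0 : 0 < θ := by positivity
  have hθ1 : θ < 1 := Real.rpow_lt_one_of_one_lt_of_neg (by norm_num) (by linarith)
  refine ⟨ρ, hρ, C * 2 ^ d * (1 - θ)⁻¹,
    mul_nonneg (by positivity) (inv_nonneg.2 (by linarith)), fun X α M hq hM => ?_⟩
  have hM0 : 0 < M := (div_pos hρ hq).trans_le hM
  set f : EuclideanSpace ℝ (Fin d) → ℝ := fun ω =>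
    (1 + ‖ω‖ ^ 2) ^ (-τ) * ‖exponentialSum X α ω‖ ^ 2 with hf
  have hfi : Integrable f := integrable_mul_norm_sq_exponentialSum X α (integrable_weight hτ)
  set s : ℕ → Set (EuclideanSpace ℝ (Fin d)) := fun m => Metric.ball 0 (2 ^ m * M) with hs
  have hsmono : Monotone s := fun m n hmn => Metric.ball_subset_ball (by
    gcongr; norm_num)
  set B : ℝ := C * 2 ^ d * M ^ ((d : ℝ) - 2 * τ) * ∑ x, α x ^ 2 with hB
  have hstep (m : ℕ) : ∫ ω in s (m + 1), f ω ≤ (∫ ω in s m, f ω) + B * θ ^ m := by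
    have hr0 : 0 < 2 ^ m * M := by positivity
    have hsplit : ∫ ω in s (m + 1), f ω = (∫ ω in s m, f ω) + ∫ ω in s (m + 1) \ s m, f ω := by
      rw [setIntegral_sdiff measurableSet_ball hfi.integrableOn (hsmono m.le_succ)]
      ring
    rw [hsplit]
    gcongr
    have hSi : IntegrableOn (fun ω => ‖exponentialSum X α ω‖ ^ 2) (s (m + 1)) :=
      (((continuous_exponentialSum X α).norm.pow 2).continuousOn.integrableOn_compact
        (isCompact_closedBall 0 (2 ^ (m + 1) * M))).mono_set Metric.ball_subset_closedBall
    calc ∫ ω in s (m + 1) \ s m, f ω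
        ≤ ∫ ω in s (m + 1) \ s m, (2 ^ m * M) ^ (-(2 * τ)) * ‖exponentialSum X α ω‖ ^ 2 := by
          refine setIntegral_mono_on hfi.integrableOn ((hSi.mono_set Set.sdiff_subset).const_mul _)
            (measurableSet_ball.diff measurableSet_ball) fun ω hω => ?_
          have h1 : 2 ^ m * M ≤ ‖ω‖ := by
            simpa [hs] using hω.2
          have h2 : (1 + ‖ω‖ ^ 2) ^ (-τ) ≤ (2 ^ m * M) ^ (-(2 * τ)) := by
            rw [show -(2 * τ) = 2 * -τ by ring, Real.rpow_mul hr0.le, Real.rpow_two]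
            refine Real.rpow_le_rpow_of_nonpos (by positivity) ?_ (by linarith)
            have : (2 ^ m * M) ^ 2 ≤ ‖ω‖ ^ 2 := by gcongr
            linarith
          exact mul_le_mul_of_nonneg_right h2 (by positivity)
      _ = (2 ^ m * M) ^ (-(2 * τ)) * ∫ ω in s (m + 1) \ s m, ‖exponentialSum X α ω‖ ^ 2 :=
          integral_const_mul _ _
      _ ≤ (2 ^ m * M) ^ (-(2 * τ)) * ∫ ω in s (m + 1), ‖exponentialSum X α ω‖ ^ 2 := by
          gcongr ?_ * ?_
          exact setIntegral_mono_set hSi (.of_forall fun ω => by positivity)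
            Set.sdiff_subset.eventuallyLE
      _ ≤ (2 ^ m * M) ^ (-(2 * τ)) * (C * (2 ^ (m + 1) * M) ^ d * ∑ x, α x ^ 2) := by
          gcongr
          refine hball X α _ hq (hM.trans ?_)
          exact le_mul_of_one_le_left hM0.le (one_le_pow₀ (by norm_num))
      _ = B * θ ^ m := by
          have h1 : (2 ^ m * M) ^ (-(2 * τ)) * (2 ^ m * M) ^ d =
              M ^ ((d : ℝ) - 2 * τ) * θ ^ m := by
            rw [← Real.rpow_natCast _ d, ← Real.rpow_add hr0, neg_add_eq_sub,
              Real.mul_rpow (by positivity) hM0.le, hθ, ← Real.rpow_natCast, ← Real.rpow_natCast,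
              ← Real.rpow_mul (by norm_num), ← Real.rpow_mul (by norm_num), mul_comm (m : ℝ),
              mul_comm]
          rw [hB, show (2 : ℝ) ^ (m + 1) * M = 2 * (2 ^ m * M) by ring, mul_pow 2]
          linear_combination (C * 2 ^ d * ∑ x, α x ^ 2) * h1
  have hB0 : 0 ≤ B := by positivity
  have hsum (m : ℕ) : ∫ ω in s m, f ω ≤
      (∫ ω in s 0, f ω) + B * ∑ i ∈ Finset.range m, θ ^ i := by
    induction m with
    | zero => simp
    | succ m ih => rw [Finset.sum_range_succ, mul_add]; linarith [hstep m]
  have hunion : ⋃ m, s m = Set.univ := by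
    refine Set.eq_univ_of_forall fun ω => Set.mem_iUnion.2 ?_
    obtain ⟨m, hm⟩ := pow_unbounded_of_one_lt (‖ω‖ / M) (one_lt_two (α := ℝ))
    exact ⟨m, by simpa [hs] using (div_lt_iff₀ hM0).1 hm⟩
  have hlim := tendsto_setIntegral_of_monotone (μ := volume) (f := f)
    (fun m => (measurableSet_ball : MeasurableSet (s m))) hsmono hfi.integrableOn
  rw [hunion, setIntegral_univ] at hlim
  refine le_of_tendsto' hlim fun m => (hsum m).trans ?_
  have h0 : s 0 = Metric.ball 0 M := by simp [hs]
  rw [h0]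
  refine add_le_add_right ?_ _
  calc B * ∑ i ∈ Finset.range m, θ ^ i ≤ B * (1 - θ)⁻¹ := by
        gcongr
        rw [← tsum_geometric_of_lt_one hθ0.le hθ1]
        exact (summable_geometric_of_lt_one hθ0.le hθ1).sum_le_tsum _ fun i _ => by positivity
    _ = _ := by rw [hB]; ring

/-! ### Comparison of the tail with the whole energy. -/

theorem mainTheorem6 (d : ℕ) (Ω : Set (EuclideanSpace ℝ (Fin d)))
    (hΩ : Bornology.IsBounded Ω) (τ : ℝ) (hτ : (d : ℝ) / 2 < τ)
    (ε : ℝ) (hε : ε ∈ Set.Ioo (0 : ℝ) 1) :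
    ∃ a : ℝ, 0 < a ∧
      ∀ X : Finset (EuclideanSpace ℝ (Fin d)), (X : Set (EuclideanSpace ℝ (Fin d))) ⊆ Ω →
        X.Nontrivial → ∀ α : X → ℝ,
          Integrable (fun ω : EuclideanSpace ℝ (Fin d) =>
            (1 + ‖ω‖ ^ 2) ^ (-τ) * ‖exponentialSum X α ω‖ ^ 2) volume ∧
          ∀ R : ℝ, max a Real.pi / separationDistance X ≤ R →
            (1 - ε) * ∫ ω : EuclideanSpace ℝ (Fin d),
                (1 + ‖ω‖ ^ 2) ^ (-τ) * ‖exponentialSum X α ω‖ ^ 2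
              ≤ ∫ ω in Metric.ball (0 : EuclideanSpace ℝ (Fin d)) (2 * R),
                (1 + ‖ω‖ ^ 2) ^ (-τ) * ‖exponentialSum X α ω‖ ^ 2 := by
  obtain ⟨c, hc, hlow⟩ := exists_le_integral_weight d hτ (Metric.diam Ω)
  obtain ⟨ρ, hρ, C, hC, htail⟩ := exists_integral_weight_tail_le d hτ
  obtain ⟨a, haC, haρ⟩ : ∃ a : ℝ, C * a ^ ((d : ℝ) - 2 * τ) ≤ ε * c ∧ ρ ≤ a := by
    have hlim : Filter.Tendsto (fun a : ℝ => C * a ^ ((d : ℝ) - 2 * τ)) Filter.atTop (nhds 0) := by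
      have := (tendsto_rpow_neg_atTop (y := 2 * τ - d) (by linarith)).const_mul C
      simpa using this
    exact ((hlim.eventually (ge_mem_nhds (mul_pos hε.1 hc))).and
      (Filter.eventually_ge_atTop ρ)).exists
  have ha : 0 < a := hρ.trans_le haρ
  refine ⟨a, ha, fun X hXΩ hX α =>
    ⟨integrable_mul_norm_sq_exponentialSum X α (integrable_weight hτ), fun R hR => ?_⟩⟩
  obtain ⟨⟨x, hx, y, hy, hxy, hq⟩, -⟩ := separationDistance_eq_min hX
  have hq0 : 0 < separationDistance X := by
    rw [hq]
    exact norm_pos_iff.2 (sub_ne_zero.2 hxy)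
  have hqD : separationDistance X ≤ Metric.diam Ω := by
    rw [hq, ← dist_eq_norm]
    exact Metric.dist_le_diam_of_mem hΩ (hXΩ hx) (hXΩ hy)
  have haR : a / separationDistance X ≤ 2 * R := by
    have h1 : a / separationDistance X ≤ R := le_trans (by gcongr; exact le_max_left _ _) hR
    have h2 : 0 < a / separationDistance X := div_pos ha hq0
    linarith
  have h1 := htail X α (2 * R) hq0 (le_trans (by gcongr) haR)
  have h2 := hlow X α hq0 hqD
  -- The negative exponent allows replacing `2R` by `a / q`, which produces the same power of `q` as
  -- the lower bound.
  have h3 : C * (2 * R) ^ ((d : ℝ) - 2 * τ) * ∑ x, α x ^ 2 ≤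
      ε * (c * separationDistance X ^ (2 * τ - d) * ∑ x, α x ^ 2) := by
    calc C * (2 * R) ^ ((d : ℝ) - 2 * τ) * ∑ x, α x ^ 2
        ≤ C * (a / separationDistance X) ^ ((d : ℝ) - 2 * τ) * ∑ x, α x ^ 2 := by
          gcongr ?_ * ?_ * ?_
          exact Real.rpow_le_rpow_of_nonpos (div_pos ha hq0) haR (by linarith)
      _ = C * a ^ ((d : ℝ) - 2 * τ) * separationDistance X ^ (2 * τ - d) * ∑ x, α x ^ 2 := by
          rw [Real.div_rpow ha.le hq0.le, div_eq_mul_inv, ← Real.rpow_neg hq0.le, neg_sub]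
          ring
      _ ≤ ε * c * separationDistance X ^ (2 * τ - d) * ∑ x, α x ^ 2 := by gcongr
      _ = _ := by ring
  have h4 := mul_le_mul_of_nonneg_left h2 hε.1.le
  linarith
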